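/- **Fully explicit no-arbitrage domain for the Vanishing Downward SVI.** Let $\Phi$ be the standard normal distribution function and, for a strike $\kappa>0$ and $u>0$, let $$C_{BS}(\kappa,u)=\Phi\Bigl(-\frac{\log\kappa}{u}+\frac u2\Bigr)-\kappa\,\Phi\Bigl(-\frac{\log\kappa}{u}-\frac u2\Bigr),$$ with $C_{BS}(\kappa,u)=(1-\kappa)^+$ if $\kappa=0$ or $u=0$. A total variance smile $w:\mathbb R\to[0,\infty)$ is called *(butterfly) arbitrage-free* if the call price curve $C(\kappa)=C_{BS}\bigl(\kappa,\sqrt{w(\log\kappa)}\bigr)$ (with $C(0)=1$) is convex on $[0,\infty)$ and satisfies $(1-\kappa)^+\le C(\kappa)\le 1$ for every $\kappa\ge 0$. For $b>0$, $m\in\mathbb R$, $\sigma>0$, the Vanishing Downward SVI is the SVI smile with $a=0$ and $\rho=-1$, $$SVI(k)=b\Bigl(-(k-m)+\sqrt{(k-m)^2+\sigma^2}\Bigr),\qquad k\in\mathbb R,$$ and we write $\mu=m/\sigma$. For $0<b<1$ and $\frac{2+b}{4-b}<x<1$ define $$\mu^*(x)=\frac{2(1-x)(2x^2-8x-1)+\sqrt{4b^2x^6+8b^2x^5+8x^4(8-b^2)-4x^3(5b^2+32)+x^2(96-b^2)+2x(5b^2-16)+4+3b^2}}{2\sqrt{1-x^2}\,(2x^2-2x-1)},$$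 $$\sigma^*(x)=-\frac{4b\sqrt{1-x^2}\,(1-x-2x^2)}{4\bigl(2-x-\mu^*(x)\sqrt{1-x^2}\bigr)^2-b^2(1+x)^2}.$$ 1. A Vanishing Downward SVI with $b=1$ is arbitrage-free if and only if $\mu>0$ and $\sigma\ge\frac1\mu$. 2. A Vanishing Downward SVI with $0<b<1$ is arbitrage-free if and only if it can be parametrized, with the same $b$ and $\sigma$, as $$SVI(k)=b\sigma\Biggl(-\frac k\sigma-\mu^*(x)+\sqrt{\Bigl(\frac k\sigma+\mu^*(x)\Bigr)^2+1}\Biggr)\qquad(k\in\mathbb R)$$ for some $x$ with $\frac{2+b}{4-b}<x<1$ and $\sigma\ge\sigma^*(x)$. -/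

import Mathlib

noncomputable section

/-- The cumulative distribution function of the standard normal law. -/
def stdNormalCDF (z : ℝ) : ℝ :=
  ProbabilityTheory.cdf (ProbabilityTheory.gaussianReal 0 1) z

/-- Normalized Black-Scholes call price (unit underlyer) with strike `κ` and square root of the total
variance `u`, so that the log-moneyness is `k = log κ`. For `κ = 0` or `u = 0` it is the intrinsic
value `(1 - κ)⁺`. -/
def bsCall (κ u : ℝ) : ℝ :=
  if 0 < κ ∧ 0 < u then
    stdNormalCDF (-(Real.log κ) / u + u / 2) - κ * stdNormalCDF (-(Real.log κ) / u - u / 2)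
  else max (1 - κ) 0

/-- The call price curve, as a function of the strike `κ`, of the total variance smile `w`
(a function of the log-moneyness `k = log κ`). -/
def smileCall (w : ℝ → ℝ) (κ : ℝ) : ℝ :=
  bsCall κ (Real.sqrt (w (Real.log κ)))

/-- A total variance smile `w` is free of butterfly arbitrage if its call price curve is convex in the
strike `κ ≥ 0` and satisfies `(1 - κ)⁺ ≤ C(κ) ≤ 1`. -/
def IsButterflyArbitrageFree (w : ℝ → ℝ) : Prop :=
  (∀ k, 0 ≤ w k) ∧
  ConvexOn ℝ (Set.Ici 0) (smileCall w) ∧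
  ∀ κ : ℝ, 0 ≤ κ → max (1 - κ) 0 ≤ smileCall w κ ∧ smileCall w κ ≤ 1

/-- The SVI total variance `k ↦ a + b (ρ (k - m) + √((k - m)² + σ²))`. -/
def svi (a b ρ m σ : ℝ) (k : ℝ) : ℝ :=
  a + b * (ρ * (k - m) + Real.sqrt ((k - m) ^ 2 + σ ^ 2))

/-- The Vanishing Downward SVI: `a = 0` and `ρ = -1`. -/
def vanishingDownwardSVI (b m σ : ℝ) : ℝ → ℝ :=
  svi 0 b (-1) m σ

/-- The function `μ*` (depending on `b`). -/
def muStar (b x : ℝ) : ℝ :=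
  (2 * (1 - x) * (2 * x ^ 2 - 8 * x - 1) +
      Real.sqrt (4 * b ^ 2 * x ^ 6 + 8 * b ^ 2 * x ^ 5 + 8 * x ^ 4 * (8 - b ^ 2)
        - 4 * x ^ 3 * (5 * b ^ 2 + 32) + x ^ 2 * (96 - b ^ 2)
        + 2 * x * (5 * b ^ 2 - 16) + 4 + 3 * b ^ 2)) /
    (2 * Real.sqrt (1 - x ^ 2) * (2 * x ^ 2 - 2 * x - 1))

/-- The function `σ*` (depending on `b`). -/
def sigmaStar (b x : ℝ) : ℝ :=
  -(4 * b * Real.sqrt (1 - x ^ 2) * (1 - x - 2 * x ^ 2)) /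
    (4 * (2 - x - muStar b x * Real.sqrt (1 - x ^ 2)) ^ 2 - b ^ 2 * (1 + x) ^ 2)

end

open Filter Topology Set

noncomputable section

/-! The price bounds are automatic, and convexity of the call curve amounts to nonnegativity of
Durrleman's function. With t the reciprocal of the normalized variance, this reads z² - b² ≥ c r(t)
for all t > 0, where z = 1 + M t + 3 t², r(t) = t (1 - 3 t²) / (1 + t²), M = 2 m / σ and c = 4 b /
σ.

For b = 1 the binding constraint is the limit t → 0, namely c ≤ 2 M. For b < 1, z starts at 1 and
cannot reach b while 3 t² < 1, where r > 0; so c is bounded there by (z² - b²) / r. Critical points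
of this ratio solve `criticalQuadratic` = 0. One exists, and any critical point with z > b is a
global minimum on 3 t² < 1 (`vdsDurrleman_nonneg_of_tangent`), so testing one point τ suffices
(`forall_vdsDurrleman_nonneg_iff`).

Put x = (1 - τ²) / (1 + τ²). Solving the quadratic for -m / σ gives μ*, and the inequality at τ
becomes σ ≥ σ*. -/

/-! ### Gaussian calculus and Black-Scholes bounds -/

/-- The density of the standard normal law. -/
def stdNormalPDF (z : ℝ) : ℝ := (Real.sqrt (2 * Real.pi))⁻¹ * Real.exp (-z ^ 2 / 2)

lemma stdNormalPDF_pos (z : ℝ) : 0 < stdNormalPDF z := by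
  unfold stdNormalPDF; positivity

lemma hasDerivAt_stdNormalPDF (z : ℝ) : HasDerivAt stdNormalPDF (-z * stdNormalPDF z) z := by
  have h : HasDerivAt (fun z : ℝ => -z ^ 2 / 2) (-z) z := by
    have := ((hasDerivAt_pow 2 z).neg).div_const 2
    refine this.congr_deriv ?_
    norm_num; ring
  refine (h.exp.const_mul (Real.sqrt (2 * Real.pi))⁻¹).congr_deriv ?_
  unfold stdNormalPDF; ring

lemma gaussianPDFReal_zero_one : ProbabilityTheory.gaussianPDFReal 0 1 = stdNormalPDF := by
  ext z
  simp [ProbabilityTheory.gaussianPDFReal, stdNormalPDF]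

lemma stdNormalCDF_eq_integral (z : ℝ) : stdNormalCDF z = ∫ t in Iic z, stdNormalPDF t := by
  rw [stdNormalCDF, ProbabilityTheory.cdf_eq_real, MeasureTheory.measureReal_def,
    ProbabilityTheory.gaussianReal_apply_eq_integral 0 one_ne_zero, gaussianPDFReal_zero_one,
    ENNReal.toReal_ofReal]
  exact MeasureTheory.integral_nonneg fun t => (stdNormalPDF_pos t).le

lemma hasDerivAt_stdNormalCDF (z : ℝ) : HasDerivAt stdNormalCDF (stdNormalPDF z) z := by
  have hcont : Continuous stdNormalPDF :=
    continuous_iff_continuousAt.2 fun z => (hasDerivAt_stdNormalPDF z).continuousAt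
  have hint : MeasureTheory.Integrable stdNormalPDF :=
    gaussianPDFReal_zero_one ▸ ProbabilityTheory.integrable_gaussianPDFReal 0 1
  have heq : stdNormalCDF = fun x => (∫ t in (0 : ℝ)..x, stdNormalPDF t) + stdNormalCDF 0 := by
    ext x
    rw [stdNormalCDF_eq_integral, stdNormalCDF_eq_integral,
      ← intervalIntegral.integral_Iic_sub_Iic hint.integrableOn hint.integrableOn]
    ring
  rw [heq]
  exact (intervalIntegral.integral_hasDerivAt_right (hcont.intervalIntegrable _ _)
    hcont.stronglyMeasurable.stronglyMeasurableAtFilter hcont.continuousAt).add_const _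

lemma stdNormalPDF_sub (t u : ℝ) :
    stdNormalPDF (t - u) = stdNormalPDF t * Real.exp (u * t - u ^ 2 / 2) := by
  unfold stdNormalPDF
  rw [mul_assoc, ← Real.exp_add]
  congr 2; ring

/-- As a function of t, Φ(t) - κ Φ(t - u) increases up to d and decreases after it, so its value at
d dominates its limits 0 and 1 - κ. -/
lemma intrinsic_le_blackScholes {κ u : ℝ} (hκ : 0 < κ) (hu : 0 < u) :
    max (1 - κ) 0 ≤ stdNormalCDF (-(Real.log κ) / u + u / 2)
      - κ * stdNormalCDF (-(Real.log κ) / u - u / 2) := by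
  set d := -(Real.log κ) / u + u / 2 with hd
  have hdu : -(Real.log κ) / u - u / 2 = d - u := by rw [hd]; ring
  have hud : u * d = u ^ 2 / 2 - Real.log κ := by rw [hd]; field_simp; ring
  have hder (t : ℝ) : HasDerivAt (fun t => stdNormalCDF t - κ * stdNormalCDF (t - u))
      (stdNormalPDF t * (1 - Real.exp (Real.log κ + (u * t - u ^ 2 / 2)))) t := by
    have h1 : HasDerivAt (fun t => stdNormalCDF (t - u)) (stdNormalPDF (t - u)) t :=
      (hasDerivAt_stdNormalCDF (t - u)).comp_sub_const t u
    refine ((hasDerivAt_stdNormalCDF t).sub (h1.const_mul κ)).congr_deriv ?_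
    rw [stdNormalPDF_sub, Real.exp_add, Real.exp_log hκ]; ring
  have hcont : Continuous (fun t => stdNormalCDF t - κ * stdNormalCDF (t - u)) :=
    continuous_iff_continuousAt.2 fun t => (hder t).continuousAt
  have hdiff : Differentiable ℝ (fun t => stdNormalCDF t - κ * stdNormalCDF (t - u)) :=
    fun t => (hder t).differentiableAt
  have hmono : MonotoneOn (fun t => stdNormalCDF t - κ * stdNormalCDF (t - u)) (Iic d) := by
    refine monotoneOn_of_deriv_nonneg (convex_Iic d) hcont.continuousOn hdiff.differentiableOn ?_
    intro t ht
    rw [interior_Iic] at ht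
    rw [(hder t).deriv]
    have : u * t ≤ u * d := mul_le_mul_of_nonneg_left (le_of_lt ht) hu.le
    exact mul_nonneg (stdNormalPDF_pos t).le
      (sub_nonneg.2 (Real.exp_le_one_iff.2 (by linarith)))
  have hanti : AntitoneOn (fun t => stdNormalCDF t - κ * stdNormalCDF (t - u)) (Ici d) := by
    refine antitoneOn_of_deriv_nonpos (convex_Ici d) hcont.continuousOn hdiff.differentiableOn ?_
    intro t ht
    rw [interior_Ici] at ht
    rw [(hder t).deriv]
    have : u * d ≤ u * t := mul_le_mul_of_nonneg_left (le_of_lt ht) hu.le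
    exact mul_nonpos_of_nonneg_of_nonpos (stdNormalPDF_pos t).le
      (sub_nonpos.2 (Real.one_le_exp (by linarith)))
  have hbot : Tendsto (fun t => stdNormalCDF t - κ * stdNormalCDF (t - u)) atBot (𝓝 (0 - κ * 0)) :=
    (ProbabilityTheory.tendsto_cdf_atBot _).sub
      (((ProbabilityTheory.tendsto_cdf_atBot _).comp
        (tendsto_atBot_add_const_right _ (-u) tendsto_id)).const_mul κ)
  have htop : Tendsto (fun t => stdNormalCDF t - κ * stdNormalCDF (t - u)) atTop (𝓝 (1 - κ * 1)) :=
    (ProbabilityTheory.tendsto_cdf_atTop _).sub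
      (((ProbabilityTheory.tendsto_cdf_atTop _).comp
        (tendsto_atTop_add_const_right _ (-u) tendsto_id)).const_mul κ)
  rw [hdu]
  refine max_le ?_ ?_
  · refine le_of_tendsto (by simpa using htop) ?_
    filter_upwards [eventually_ge_atTop d] with t ht
    exact hanti self_mem_Ici ht ht
  · refine le_of_tendsto (by simpa using hbot) ?_
    filter_upwards [eventually_le_atBot d] with t ht
    exact hmono ht self_mem_Iic ht

lemma bsCall_bounds {κ u : ℝ} (hκ : 0 ≤ κ) : max (1 - κ) 0 ≤ bsCall κ u ∧ bsCall κ u ≤ 1 := by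
  unfold bsCall
  split_ifs with h
  · refine ⟨intrinsic_le_blackScholes h.1 h.2, ?_⟩
    have h1 : stdNormalCDF (-(Real.log κ) / u + u / 2) ≤ 1 := ProbabilityTheory.cdf_le_one _ _
    have h2 : 0 ≤ stdNormalCDF (-(Real.log κ) / u - u / 2) := ProbabilityTheory.cdf_nonneg _ _
    nlinarith [mul_nonneg hκ h2]
  · exact ⟨le_rfl, max_le (by linarith) zero_le_one⟩

/-! ### Convexity in the strike and Durrleman's condition -/

/-- The derivative of the call price in the strike, as a function of the log-moneyness, for the
implied volatility `u` with derivative `u₁`. -/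
def callSlope (u u₁ : ℝ → ℝ) (k : ℝ) : ℝ :=
  -stdNormalCDF (-k / u k - u k / 2) + stdNormalPDF (-k / u k - u k / 2) * u₁ k

section Slope

variable {u u₁ u₂ : ℝ → ℝ}

lemma hasDerivAt_neg_div (hpos : ∀ k, 0 < u k) (hu : ∀ k, HasDerivAt u (u₁ k) k) (k : ℝ) :
    HasDerivAt (fun k => -k / u k) (-1 / u k + k * u₁ k / u k ^ 2) k := by
  refine ((hasDerivAt_id k).neg.div (hu k) (hpos k).ne').congr_deriv ?_
  have := (hpos k).ne'
  simp only [id, Pi.neg_apply]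
  field_simp
  ring

lemma hasDerivAt_blackScholes (hpos : ∀ k, 0 < u k) (hu : ∀ k, HasDerivAt u (u₁ k) k)
    {κ : ℝ} (hκ : 0 < κ) :
    HasDerivAt (fun κ => bsCall κ (u (Real.log κ))) (callSlope u u₁ (Real.log κ)) κ := by
  have hc (k : ℝ) : HasDerivAt (fun k => stdNormalCDF (-k / u k + u k / 2)
      - Real.exp k * stdNormalCDF (-k / u k - u k / 2)) (Real.exp k * callSlope u u₁ k) k := by
    have h0 := hasDerivAt_neg_div hpos hu k
    have h1 := (hasDerivAt_stdNormalCDF (-k / u k + u k / 2)).comp k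
      (h0.add ((hu k).div_const 2))
    have h2 := (hasDerivAt_stdNormalCDF (-k / u k - u k / 2)).comp k
      (h0.sub ((hu k).div_const 2))
    refine (h1.sub ((Real.hasDerivAt_exp k).mul h2)).congr_deriv ?_
    have hd : -k / u k - u k / 2 = (-k / u k + u k / 2) - u k := by ring
    -- The identity κ φ(d₂) = φ(d₁) cancels the terms coming from the derivative of -k / u.
    have hφ : Real.exp k * stdNormalPDF (-k / u k - u k / 2)
        = stdNormalPDF (-k / u k + u k / 2) := by
      rw [hd, stdNormalPDF_sub, mul_left_comm, ← Real.exp_add]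
      have : k + (u k * (-k / u k + u k / 2) - u k ^ 2 / 2) = 0 := by
        have := (hpos k).ne'
        field_simp; ring
      rw [this, Real.exp_zero, mul_one]
    simp only [callSlope, Function.comp, Pi.sub_apply]
    rw [← hφ]
    ring
  have h := (hc (Real.log κ)).comp κ (Real.hasDerivAt_log hκ.ne')
  rw [Real.exp_log hκ] at h
  have h' := h.congr_deriv (show _ = callSlope u u₁ (Real.log κ) by field_simp)
  refine h'.congr_of_eventuallyEq ?_
  filter_upwards [lt_mem_nhds hκ] with x hx
  simp only [bsCall, Function.comp, if_pos (And.intro hx (hpos (Real.log x))), Real.exp_log hx]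

lemma hasDerivAt_callSlope (hpos : ∀ k, 0 < u k) (hu : ∀ k, HasDerivAt u (u₁ k) k)
    (hu₁ : ∀ k, HasDerivAt u₁ (u₂ k) k) (k : ℝ) :
    HasDerivAt (callSlope u u₁) (stdNormalPDF (-k / u k - u k / 2) / u k *
      (u k * u₂ k + (1 - k * u₁ k / u k) ^ 2 - u k ^ 2 * u₁ k ^ 2 / 4)) k := by
  have h0 := (hasDerivAt_neg_div hpos hu k).sub ((hu k).div_const 2)
  have h1 := (hasDerivAt_stdNormalCDF (-k / u k - u k / 2)).comp k h0
  have h2 := (hasDerivAt_stdNormalPDF (-k / u k - u k / 2)).comp k h0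
  refine (h1.neg.add (h2.mul (hu₁ k))).congr_deriv ?_
  have := (hpos k).ne'
  simp only [Function.comp, Pi.sub_apply]
  field_simp
  ring

lemma convexOn_blackScholes_iff (hpos : ∀ k, 0 < u k) (hu : ∀ k, HasDerivAt u (u₁ k) k)
    (hu₁ : ∀ k, HasDerivAt u₁ (u₂ k) k) :
    ConvexOn ℝ (Ici 0) (fun κ => bsCall κ (u (Real.log κ))) ↔
      ∀ k, 0 ≤ u k * u₂ k + (1 - k * u₁ k / u k) ^ 2 - u k ^ 2 * u₁ k ^ 2 / 4 := by
  have hder {κ : ℝ} (hκ : 0 < κ) := hasDerivAt_blackScholes hpos hu hκ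
  have hslope := hasDerivAt_callSlope hpos hu hu₁
  have hfac (k : ℝ) : 0 < stdNormalPDF (-k / u k - u k / 2) / u k :=
    div_pos (stdNormalPDF_pos _) (hpos k)
  constructor
  · intro h k
    have hmono := (h.subset Ioi_subset_Ici_self (convex_Ioi 0)).monotoneOn_deriv
      fun κ hκ => (hder hκ).differentiableAt
    have hE : Monotone (callSlope u u₁) := by
      intro x y hxy
      have := hmono (Real.exp_pos x) (Real.exp_pos y) (Real.exp_le_exp.2 hxy)
      rwa [(hder (Real.exp_pos x)).deriv, (hder (Real.exp_pos y)).deriv, Real.log_exp,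
        Real.log_exp] at this
    have h0 := (hE.monotoneOn univ).derivWithin_nonneg (x := k)
    rw [derivWithin_univ, (hslope k).deriv] at h0
    exact nonneg_of_mul_nonneg_right h0 (hfac k)
  · intro h
    have hE : Monotone (callSlope u u₁) :=
      monotone_of_deriv_nonneg (fun k => (hslope k).differentiableAt) fun k => by
        rw [(hslope k).deriv]; exact mul_nonneg (hfac k).le (h k)
    refine MonotoneOn.convexOn_of_deriv (convex_Ici 0) ?_ ?_ ?_
    · intro κ hκ
      -- Continuity at strike 0 is not given by the derivative; it follows by squeezing between 1 -
      -- κ and 1.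
      rcases eq_or_lt_of_le (show (0 : ℝ) ≤ κ from hκ) with rfl | hκ
      · have h0 : bsCall 0 (u (Real.log 0)) = 1 := by simp [bsCall]
        rw [ContinuousWithinAt, h0]
        refine tendsto_of_tendsto_of_tendsto_of_le_of_le' (g := fun κ : ℝ => 1 - κ)
          (h := fun _ => 1) ?_ tendsto_const_nhds ?_ ?_
        · have : Tendsto (fun κ : ℝ => 1 - κ) (𝓝 0) (𝓝 (1 - 0)) :=
            (continuous_const.sub continuous_id).tendsto 0
          rw [sub_zero] at this
          exact this.mono_left nhdsWithin_le_nhds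
        · filter_upwards [self_mem_nhdsWithin] with x hx
          exact (le_max_left _ _).trans (bsCall_bounds hx).1
        · filter_upwards [self_mem_nhdsWithin] with x hx
          exact (bsCall_bounds hx).2
      · exact (hder hκ).continuousAt.continuousWithinAt
    · rw [interior_Ici]
      exact fun κ hκ => (hder hκ).differentiableAt.differentiableWithinAt
    · rw [interior_Ici]
      intro x hx y hy hxy
      rw [(hder hx).deriv, (hder hy).deriv]
      exact hE (Real.log_le_log hx hxy)

end Slope

/-- Durrleman's condition characterizes the absence of butterfly arbitrage for positive, twice
differentiable smiles. -/
theorem isButterflyArbitrageFree_iff_durrleman {w w₁ w₂ : ℝ → ℝ} (hpos : ∀ k, 0 < w k)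
    (hw : ∀ k, HasDerivAt w (w₁ k) k) (hw₁ : ∀ k, HasDerivAt w₁ (w₂ k) k) :
    IsButterflyArbitrageFree w ↔ ∀ k, 0 ≤ (1 - k * w₁ k / (2 * w k)) ^ 2
      - w₁ k ^ 2 / 4 * (1 / w k + 1 / 4) + w₂ k / 2 := by
  have hspos (k : ℝ) : 0 < Real.sqrt (w k) := Real.sqrt_pos.2 (hpos k)
  have hu (k : ℝ) : HasDerivAt (fun k => Real.sqrt (w k)) (w₁ k / (2 * Real.sqrt (w k))) k :=
    (hw k).sqrt (hpos k).ne'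
  have hu₁ (k : ℝ) : HasDerivAt (fun k => w₁ k / (2 * Real.sqrt (w k)))
      (w₂ k / (2 * Real.sqrt (w k)) - w₁ k ^ 2 / (4 * Real.sqrt (w k) ^ 3)) k := by
    refine ((hw₁ k).div ((hu k).const_mul 2) (mul_pos two_pos (hspos k)).ne').congr_deriv ?_
    have := (hspos k).ne'
    field_simp
    ring
  have key := convexOn_blackScholes_iff hspos hu hu₁
  have hrw (k : ℝ) : Real.sqrt (w k) *
        (w₂ k / (2 * Real.sqrt (w k)) - w₁ k ^ 2 / (4 * Real.sqrt (w k) ^ 3))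
        + (1 - k * (w₁ k / (2 * Real.sqrt (w k))) / Real.sqrt (w k)) ^ 2
        - Real.sqrt (w k) ^ 2 * (w₁ k / (2 * Real.sqrt (w k))) ^ 2 / 4
      = (1 - k * w₁ k / (2 * w k)) ^ 2 - w₁ k ^ 2 / 4 * (1 / w k + 1 / 4) + w₂ k / 2 := by
    have h2 : w k = Real.sqrt (w k) ^ 2 := (Real.sq_sqrt (hpos k).le).symm
    have := (hspos k).ne'
    generalize Real.sqrt (w k) = s at *
    rw [h2]
    field_simp
    ring
  simp only [hrw] at key
  rw [← key]
  exact ⟨fun h => h.2.1, fun h => ⟨fun k => (hpos k).le, h, fun κ hκ => bsCall_bounds hκ⟩⟩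

/-! ### Durrleman's condition in the coordinate t -/

/-- Durrleman's function of the Vanishing Downward SVI, up to a positive factor, in the variable
`t = 1 / n`, where `n` is the normalized total variance `SVI / (b σ)`; here `M = 2 μ` and
`c = 4 b / σ`. -/
def vdsDurrleman (b M c t : ℝ) : ℝ :=
  (1 + M * t + 3 * t ^ 2) ^ 2 - b ^ 2 - c * (t * (1 - 3 * t ^ 2) / (1 + t ^ 2))

/-- The quadratic polynomial in `z = 1 + M t + 3 t²` whose vanishing says that `t` is a critical point
of the least scale function `t ↦ σ(t)` allowed by Durrleman's condition. -/
def criticalQuadratic (b t z : ℝ) : ℝ :=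
  (1 + 6 * t ^ 2 - 3 * t ^ 4) * z ^ 2 - 2 * (1 - 3 * t ^ 2) ^ 2 * (1 + t ^ 2) * z
    + b ^ 2 * (1 - 10 * t ^ 2 - 3 * t ^ 4)

theorem isButterflyArbitrageFree_vanishingDownwardSVI_iff {b m σ : ℝ} (hb : 0 < b) (hσ : 0 < σ) :
    IsButterflyArbitrageFree (vanishingDownwardSVI b m σ) ↔
      ∀ t, 0 < t → 0 ≤ vdsDurrleman b (2 * (m / σ)) (4 * b / σ) t := by
  have hS (k : ℝ) : 0 < Real.sqrt ((k - m) ^ 2 + σ ^ 2) := Real.sqrt_pos.2 (by positivity)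
  have hSd (k : ℝ) : HasDerivAt (fun k => Real.sqrt ((k - m) ^ 2 + σ ^ 2))
      ((k - m) / Real.sqrt ((k - m) ^ 2 + σ ^ 2)) k := by
    have h := ((((hasDerivAt_id k).sub_const m).pow 2).add_const (σ ^ 2)).sqrt
      (by positivity : (k - m) ^ 2 + σ ^ 2 ≠ 0)
    refine h.congr_deriv ?_
    have := (hS k).ne'
    simp only [id, Pi.pow_apply]
    norm_num
    field_simp
  have hw (k : ℝ) : HasDerivAt (vanishingDownwardSVI b m σ)
      (b * (-1 + (k - m) / Real.sqrt ((k - m) ^ 2 + σ ^ 2))) k := by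
    have h := (((((hasDerivAt_id k).sub_const m).const_mul (-1)).add (hSd k)).const_mul b).const_add 0
    exact h.congr_deriv (by ring)
  have hw₁ (k : ℝ) : HasDerivAt (fun k => b * (-1 + (k - m) / Real.sqrt ((k - m) ^ 2 + σ ^ 2)))
      (b * σ ^ 2 / Real.sqrt ((k - m) ^ 2 + σ ^ 2) ^ 3) k := by
    have h := ((((hasDerivAt_id k).sub_const m).div (hSd k) (hS k).ne').const_add (-1)).const_mul b
    refine h.congr_deriv ?_
    have h2 := Real.sq_sqrt (by positivity : 0 ≤ (k - m) ^ 2 + σ ^ 2)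
    have := (hS k).ne'
    simp only [id]
    generalize Real.sqrt ((k - m) ^ 2 + σ ^ 2) = S at *
    field_simp
    linear_combination h2
  have hpos (k : ℝ) : 0 < vanishingDownwardSVI b m σ k := by
    have h1 : |k - m| < Real.sqrt ((k - m) ^ 2 + σ ^ 2) := by
      rw [← Real.sqrt_sq_eq_abs]
      exact Real.sqrt_lt_sqrt (sq_nonneg _) (by nlinarith)
    have h2 := le_abs_self (k - m)
    have : 0 < -1 * (k - m) + Real.sqrt ((k - m) ^ 2 + σ ^ 2) := by linarith
    simp only [vanishingDownwardSVI, svi]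
    rw [zero_add]
    exact mul_pos hb this
  rw [isButterflyArbitrageFree_iff_durrleman hpos hw hw₁]
  -- Writing (k - m) / σ = sinh (log t) makes the square root σ cosh (log t) and the total variance
  -- b σ / t.
  have key {t k : ℝ} (ht : 0 < t) (hk : k = m + σ * (t - 1 / t) / 2) :
      (1 - k * (b * (-1 + (k - m) / Real.sqrt ((k - m) ^ 2 + σ ^ 2)))
          / (2 * vanishingDownwardSVI b m σ k)) ^ 2
        - (b * (-1 + (k - m) / Real.sqrt ((k - m) ^ 2 + σ ^ 2))) ^ 2 / 4
          * (1 / vanishingDownwardSVI b m σ k + 1 / 4)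
        + b * σ ^ 2 / Real.sqrt ((k - m) ^ 2 + σ ^ 2) ^ 3 / 2
      = vdsDurrleman b (2 * (m / σ)) (4 * b / σ) t / (4 * (1 + t ^ 2) ^ 2) := by
    have hs : Real.sqrt ((k - m) ^ 2 + σ ^ 2) = σ * (t + 1 / t) / 2 := by
      rw [show (k - m) ^ 2 + σ ^ 2 = (σ * (t + 1 / t) / 2) ^ 2 by rw [hk]; field_simp; ring]
      exact Real.sqrt_sq (by positivity)
    have hv : vanishingDownwardSVI b m σ k = b * σ / t := by
      simp only [vanishingDownwardSVI, svi, hs]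
      rw [hk]; field_simp; ring
    rw [hv, hs, vdsDurrleman, hk]
    have : (1 + t ^ 2) ≠ 0 := by positivity
    have : (t ^ 2 + 1) ≠ 0 := by positivity
    field_simp
    ring
  constructor
  · intro h t ht
    have h1 := h (m + σ * (t - 1 / t) / 2)
    rw [key ht rfl] at h1
    have h2 : 0 < 4 * (1 + t ^ 2) ^ 2 := by positivity
    simpa [div_mul_cancel₀ _ h2.ne'] using mul_nonneg h1 h2.le
  · intro h k
    have hy : 0 < (k - m) / σ + Real.sqrt (((k - m) / σ) ^ 2 + 1) := by
      have h1 : |(k - m) / σ| < Real.sqrt (((k - m) / σ) ^ 2 + 1) := by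
        rw [← Real.sqrt_sq_eq_abs]
        exact Real.sqrt_lt_sqrt (sq_nonneg _) (by linarith)
      linarith [neg_abs_le ((k - m) / σ)]
    have hk : k = m + σ * (((k - m) / σ + Real.sqrt (((k - m) / σ) ^ 2 + 1))
        - 1 / ((k - m) / σ + Real.sqrt (((k - m) / σ) ^ 2 + 1))) / 2 := by
      have h2 := Real.sq_sqrt (by positivity : 0 ≤ ((k - m) / σ) ^ 2 + 1)
      have h3 : k = m + σ * ((k - m) / σ) := by field_simp; ring
      generalize Real.sqrt (((k - m) / σ) ^ 2 + 1) = s at *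
      generalize (k - m) / σ = y at *
      have h4 : 1 / (y + s) = s - y := by field_simp; linear_combination -h2
      rw [h4, h3]; ring
    rw [key hy hk]
    exact div_nonneg (h _ hy) (by positivity)

/-! ### The case b = 1 -/

/-- Necessity comes from dividing by t and letting t → 0; sufficiency from r(t) ≤ t. -/
lemma forall_vdsDurrleman_one_nonneg_iff {M c : ℝ} (hc : 0 < c) :
    (∀ t, 0 < t → 0 ≤ vdsDurrleman 1 M c t) ↔ c ≤ 2 * M := by
  constructor
  · intro h
    have hlim : Tendsto (fun t : ℝ => (M + 3 * t) * (2 + M * t + 3 * t ^ 2)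
        - c * ((1 - 3 * t ^ 2) / (1 + t ^ 2))) (𝓝[>] 0) (𝓝 (2 * M - c)) := by
      have hcont : ContinuousAt (fun t : ℝ => (M + 3 * t) * (2 + M * t + 3 * t ^ 2)
          - c * ((1 - 3 * t ^ 2) / (1 + t ^ 2))) 0 := by
        have h0 : ContinuousAt (fun t : ℝ => (1 - 3 * t ^ 2) / (1 + t ^ 2)) 0 :=
          ContinuousAt.div (by fun_prop) (by fun_prop) (by norm_num)
        fun_prop
      have := hcont.tendsto.mono_left (nhdsWithin_le_nhds (s := Ioi 0))
      convert this using 2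
      norm_num
      ring
    have h0 : 0 ≤ 2 * M - c := by
      refine ge_of_tendsto hlim ?_
      filter_upwards [self_mem_nhdsWithin] with t ht
      have ht : 0 < t := ht
      have h1 := h t ht
      have h2 : vdsDurrleman 1 M c t = t * ((M + 3 * t) * (2 + M * t + 3 * t ^ 2)
        - c * ((1 - 3 * t ^ 2) / (1 + t ^ 2))) := by
        rw [vdsDurrleman]; field_simp; ring
      rw [h2] at h1
      exact nonneg_of_mul_nonneg_right h1 ht
    linarith
  · intro h t ht
    have hM : 0 < M := by linarith
    have h1 : t * (1 - 3 * t ^ 2) / (1 + t ^ 2) ≤ t := by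
      rw [div_le_iff₀ (by positivity)]
      nlinarith [pow_pos ht 3]
    have h2 := mul_le_mul_of_nonneg_left h1 hc.le
    have h3 := mul_le_mul_of_nonneg_right h ht.le
    have h4 : 0 ≤ (M * t + 3 * t ^ 2) ^ 2 := sq_nonneg _
    unfold vdsDurrleman
    nlinarith [sq_nonneg t]

/-! ### The case 0 < b < 1: reduction to one critical point -/

/-- If z = b at a point where r > 0, Durrleman's function equals -c r < 0 there. -/
lemma three_mul_sq_pos_bound {b M c : ℝ} (hb : 0 < b) (hb1 : b < 1) (hc : 0 < c)
    (h : ∀ t, 0 < t → 3 * t ^ 2 ≤ 1 → 0 ≤ vdsDurrleman b M c t)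
    {t : ℝ} (ht : 0 < t) (ht1 : 3 * t ^ 2 < 1) : b < 1 + M * t + 3 * t ^ 2 := by
  by_contra! hle
  have hcont : ContinuousOn (fun t : ℝ => 1 + M * t + 3 * t ^ 2) (Icc 0 t) := by fun_prop
  obtain ⟨s, hs, hsb⟩ := intermediate_value_Icc' ht.le hcont
    (show b ∈ Icc _ _ from ⟨hle, by simpa using hb1.le⟩)
  have hs0 : 0 < s := by
    refine lt_of_le_of_ne hs.1 fun h0 => ?_
    rw [← h0] at hsb
    norm_num at hsb
    linarith
  have hs1 : 3 * s ^ 2 < 1 := by nlinarith [hs.2]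
  have h1 := h s hs0 hs1.le
  have h2 : 0 < c * (s * (1 - 3 * s ^ 2) / (1 + s ^ 2)) := by
    have : 0 < 1 - 3 * s ^ 2 := by linarith
    positivity
  simp only at hsb
  rw [vdsDurrleman, hsb] at h1
  linarith

/-- Write F for `vdsDurrleman`. Both n² F(1/n) and its derivative vanish at n = 1/τ, and the
second-order remainder there is nonnegative. -/
lemma vdsDurrleman_nonneg_of_tangent {b M c τ t : ℝ} (hb : 0 < b) (hb1 : b < 1) (hc : 0 < c)
    (hτ : 0 < τ) (hτ1 : 3 * τ ^ 2 < 1) (hz : b < 1 + M * τ + 3 * τ ^ 2)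
    (hQ : criticalQuadratic b τ (1 + M * τ + 3 * τ ^ 2) = 0) (h0 : vdsDurrleman b M c τ = 0)
    (ht : 0 < t) (ht1 : 3 * t ^ 2 ≤ 1) : 0 ≤ vdsDurrleman b M c t := by
  -- The left side is 2 F(τ) - τ F'(τ).
  have hslope : 2 * ((1 + M * τ + 3 * τ ^ 2) * (1 - 3 * τ ^ 2) - b ^ 2)
      - c * τ * (1 + 6 * τ ^ 2 - 3 * τ ^ 4) / (1 + τ ^ 2) ^ 2 = 0 := by
    have hne : (1 - 3 * τ ^ 2) * (1 + τ ^ 2) ≠ 0 :=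
      (mul_pos (by linarith) (by positivity)).ne'
    refine (mul_eq_zero.1 (?_ : (1 - 3 * τ ^ 2) * (1 + τ ^ 2) * _ = 0)).resolve_left hne
    have h1 : (1 - 3 * τ ^ 2) * (1 + τ ^ 2) * (c * τ * (1 + 6 * τ ^ 2 - 3 * τ ^ 4) / (1 + τ ^ 2) ^ 2)
        = c * (τ * (1 - 3 * τ ^ 2) / (1 + τ ^ 2)) * (1 + 6 * τ ^ 2 - 3 * τ ^ 4) := by
      field_simp
    unfold vdsDurrleman at h0
    unfold criticalQuadratic at hQ
    rw [mul_sub, h1]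
    linear_combination (1 + 6 * τ ^ 2 - 3 * τ ^ 4) * h0 - hQ
  have hid : τ ^ 2 * vdsDurrleman b M c t = (τ - t) ^ 2 * ((1 - 3 * t * τ) ^ 2
        + 6 * (1 + M * τ + 3 * τ ^ 2) * t * τ - b ^ 2)
      + 4 * c * τ ^ 2 * (τ - t) ^ 2 * t * (1 - τ ^ 2 - 2 * t * τ) / ((1 + t ^ 2) * (1 + τ ^ 2) ^ 2)
      + t ^ 2 * vdsDurrleman b M c τ
      + t * (τ - t) * (2 * ((1 + M * τ + 3 * τ ^ 2) * (1 - 3 * τ ^ 2) - b ^ 2)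
        - c * τ * (1 + 6 * τ ^ 2 - 3 * τ ^ 4) / (1 + τ ^ 2) ^ 2) := by
    unfold vdsDurrleman
    field_simp
    ring
  rw [hslope, h0, mul_zero, mul_zero, add_zero, add_zero] at hid
  have htτ : 0 < t * τ := mul_pos ht hτ
  -- Replacing z by b leaves (3 t τ - (1 - b))² + 2 b (1 - b).
  have h1 : 0 ≤ (1 - 3 * t * τ) ^ 2 + 6 * (1 + M * τ + 3 * τ ^ 2) * t * τ - b ^ 2 := by
    have h2 := mul_lt_mul_of_pos_right hz htτ
    nlinarith [sq_nonneg (3 * t * τ - (1 - b)), mul_pos hb (sub_pos.2 hb1)]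
  have h3 : 0 ≤ 1 - τ ^ 2 - 2 * t * τ := by nlinarith [sq_nonneg (t - τ)]
  have h4 : 0 ≤ τ ^ 2 * vdsDurrleman b M c t := by
    rw [hid]; positivity
  exact nonneg_of_mul_nonneg_right h4 (by positivity)

theorem forall_vdsDurrleman_nonneg_iff {b M c : ℝ} (hb : 0 < b) (hb1 : b < 1) (hc : 0 < c) :
    (∀ t, 0 < t → 0 ≤ vdsDurrleman b M c t) ↔
      ∃ τ, 0 < τ ∧ 3 * τ ^ 2 < 1 - b ∧ b < 1 + M * τ + 3 * τ ^ 2 ∧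
        criticalQuadratic b τ (1 + M * τ + 3 * τ ^ 2) = 0 ∧ 0 ≤ vdsDurrleman b M c τ := by
  -- T corresponds to the endpoint x = (2 + b) / (4 - b).
  obtain ⟨T, hT, hT3⟩ : ∃ T : ℝ, 0 < T ∧ 3 * T ^ 2 = 1 - b :=
    ⟨Real.sqrt ((1 - b) / 3), Real.sqrt_pos.2 (by linarith),
      by rw [Real.sq_sqrt (by linarith)]; ring⟩
  constructor
  · intro h
    have hlow {t : ℝ} := three_mul_sq_pos_bound (t := t) hb hb1 hc fun t ht _ => h t ht
    have hcont : ContinuousOn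
        (fun t : ℝ => criticalQuadratic b t (1 + M * t + 3 * t ^ 2)) (Icc 0 T) := by
      unfold criticalQuadratic; fun_prop
    have h0 : criticalQuadratic b 0 (1 + M * 0 + 3 * 0 ^ 2) < 0 := by
      unfold criticalQuadratic; nlinarith
    have hTpos : 0 < criticalQuadratic b T (1 + M * T + 3 * T ^ 2) := by
      have hz := hlow hT (by linarith)
      generalize 1 + M * T + 3 * T ^ 2 = z at hz
      have hbT : b = 1 - 3 * T ^ 2 := by linarith
      have h1 : criticalQuadratic b T z = (z - b) * ((1 + 6 * T ^ 2 - 3 * T ^ 4) * (z - b)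
          + b * (16 * T ^ 2)) := by
        unfold criticalQuadratic; rw [hbT]; ring
      rw [h1]
      have h2 : 0 < z - b := by linarith
      have h3 : 0 < 1 + 6 * T ^ 2 - 3 * T ^ 4 := by nlinarith [sq_nonneg T]
      positivity
    obtain ⟨τ, hτ, hQ⟩ := intermediate_value_Ioo hT.le hcont (show (0 : ℝ) ∈ Ioo _ _ from ⟨h0, hTpos⟩)
    have hτ3 : 3 * τ ^ 2 < 1 - b := by nlinarith [hτ.1, hτ.2]
    exact ⟨τ, hτ.1, hτ3, hlow hτ.1 (by linarith), hQ, h τ hτ.1⟩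
  · rintro ⟨τ, hτ, hτb, hz, hQ, hτ0⟩
    have hτ1 : 3 * τ ^ 2 < 1 := by linarith
    have hnear (t : ℝ) (ht : 0 < t) (ht1 : 3 * t ^ 2 ≤ 1) : 0 ≤ vdsDurrleman b M c t := by
      have hr : 0 < τ * (1 - 3 * τ ^ 2) / (1 + τ ^ 2) := by
        have : 0 < 1 - 3 * τ ^ 2 := by linarith
        positivity
      -- c₀ is the largest c allowed at τ, so that tangency holds; decreasing c to its actual value
      -- only helps where r ≥ 0.
      obtain ⟨c₀, hc₀⟩ : ∃ c₀, vdsDurrleman b M c₀ τ = 0 :=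
        ⟨((1 + M * τ + 3 * τ ^ 2) ^ 2 - b ^ 2) / (τ * (1 - 3 * τ ^ 2) / (1 + τ ^ 2)), by
          unfold vdsDurrleman; rw [div_mul_cancel₀ _ hr.ne', sub_self]⟩
      have hcc : c ≤ c₀ := by
        have : c * (τ * (1 - 3 * τ ^ 2) / (1 + τ ^ 2)) ≤ c₀ * (τ * (1 - 3 * τ ^ 2) / (1 + τ ^ 2)) := by
          unfold vdsDurrleman at hτ0 hc₀; linarith
        exact le_of_mul_le_mul_right this hr
      have h1 := vdsDurrleman_nonneg_of_tangent hb hb1 (hc.trans_le hcc) hτ hτ1 hz hQ hc₀ ht ht1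
      have h2 : 0 ≤ t * (1 - 3 * t ^ 2) / (1 + t ^ 2) := by
        have : 0 ≤ 1 - 3 * t ^ 2 := by linarith
        positivity
      have h3 := mul_le_mul_of_nonneg_right hcc h2
      unfold vdsDurrleman at h1 ⊢
      linarith
    have hTb := three_mul_sq_pos_bound hb hb1 hc hnear hT (by linarith)
    have hM : 0 < M + 6 * T := by
      have : 0 < (M + 6 * T) * T := by nlinarith
      exact pos_of_mul_pos_left this hT.le
    intro t ht
    rcases le_or_gt (3 * t ^ 2) 1 with h1 | h1
    · exact hnear t ht h1
    -- Since M > -6 T, z exceeds 1 - 6 T t + 3 t² = b + 3 (t - T)².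
    · have h2 : b < 1 + M * t + 3 * t ^ 2 := by nlinarith [mul_pos hM ht, sq_nonneg (t - T)]
      have h3 : 0 ≤ c * (t * (3 * t ^ 2 - 1) / (1 + t ^ 2)) := by
        have : 0 ≤ 3 * t ^ 2 - 1 := by linarith
        positivity
      have h4 : t * (1 - 3 * t ^ 2) / (1 + t ^ 2) = -(t * (3 * t ^ 2 - 1) / (1 + t ^ 2)) := by ring
      unfold vdsDurrleman
      rw [h4]
      nlinarith

/-! ### Passage to x, μ* and σ* -/

section Reparametrization

variable {b x : ℝ}

lemma half_lt_of_lt (hb : 0 < b) (hb1 : b < 1) (hx : (2 + b) / (4 - b) < x) :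
    2 + b < (4 - b) * x ∧ 1 / 2 < x := by
  have h : 2 + b < (4 - b) * x := by
    rw [div_lt_iff₀ (by linarith)] at hx
    linarith
  exact ⟨h, by nlinarith⟩

/-- In Y = z (1 + x) / 2 the critical equation is quadratic, with completed square W² = Δ. The value
z = b lies strictly between its roots, so z > b selects W = √Δ, which is the branch in μ*. -/
lemma eq_muStar_iff (hb : 0 < b) (hb1 : b < 1) (hx : (2 + b) / (4 - b) < x) (hx1 : x < 1) {μ t : ℝ}
    (ht : t = Real.sqrt (1 - x ^ 2) / (1 + x)) :
    μ = muStar b x ↔ b < 1 + -2 * μ * t + 3 * t ^ 2 ∧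
      criticalQuadratic b t (1 + -2 * μ * t + 3 * t ^ 2) = 0 := by
  obtain ⟨hbx, hxh⟩ := half_lt_of_lt hb hb1 hx
  have hs : 0 < Real.sqrt (1 - x ^ 2) := Real.sqrt_pos.2 (by nlinarith)
  have hs2 : Real.sqrt (1 - x ^ 2) ^ 2 = 1 - x ^ 2 := Real.sq_sqrt (by nlinarith)
  have hD : 2 * x ^ 2 - 2 * x - 1 < 0 := by nlinarith
  have h1x : 0 < 1 + x := by linarith
  unfold muStar
  set s := Real.sqrt (1 - x ^ 2) with hsdef
  set Δ := 4 * b ^ 2 * x ^ 6 + 8 * b ^ 2 * x ^ 5 + 8 * x ^ 4 * (8 - b ^ 2)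
        - 4 * x ^ 3 * (5 * b ^ 2 + 32) + x ^ 2 * (96 - b ^ 2)
        + 2 * x * (5 * b ^ 2 - 16) + 4 + 3 * b ^ 2 with hΔ
  obtain ⟨Y, hY⟩ : ∃ Y, Y = 2 - x - μ * s := ⟨_, rfl⟩
  have ht2 : t ^ 2 = (1 - x) / (1 + x) := by
    rw [ht, div_pow, hs2]; field_simp; ring
  have hz : 1 + -2 * μ * t + 3 * t ^ 2 = 2 * Y / (1 + x) := by
    rw [ht2, ht, hY]; field_simp; ring
  have ht4 : t ^ 4 = ((1 - x) / (1 + x)) ^ 2 := by rw [← ht2]; ring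
  rw [hz]
  set W := -2 * (2 * x - 1) ^ 2 - 2 * (2 * x ^ 2 - 2 * x - 1) * Y with hW
  set Wb := -2 * (2 * x - 1) ^ 2 - (2 * x ^ 2 - 2 * x - 1) * (b * (1 + x)) with hWb
  obtain ⟨q, hq⟩ : ∃ q, q = 4 * (2 * x ^ 2 - 2 * x - 1) * Y ^ 2 + 8 * (2 * x - 1) ^ 2 * Y
      - b ^ 2 * (1 + x) ^ 2 * (2 * x ^ 2 + 2 * x - 3) := ⟨_, rfl⟩
  have hcrit : criticalQuadratic b t (2 * Y / (1 + x)) = -4 * q / (1 + x) ^ 4 := by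
    unfold criticalQuadratic
    rw [ht2, ht4, hq]
    field_simp
    ring
  have hWΔ : W ^ 2 - Δ = (2 * x ^ 2 - 2 * x - 1) * q := by
    rw [hW, hΔ, hq]; ring
  have hWbΔ : Wb ^ 2 < Δ := by
    have h1 : Wb ^ 2 - Δ = (2 * x ^ 2 - 2 * x - 1)
        * (2 * b * (1 + x) * (2 * x - 1) * ((4 - b) * x - (2 + b))) := by
      rw [hWb, hΔ]; ring
    have h2 : 0 < 2 * b * (1 + x) * (2 * x - 1) * ((4 - b) * x - (2 + b)) := by
      have h3 : 0 < 2 * x - 1 := by linarith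
      have h4 : 0 < (4 - b) * x - (2 + b) := by linarith
      positivity
    nlinarith [mul_neg_of_neg_of_pos hD h2]
  have hΔ0 : 0 ≤ Δ := (sq_nonneg Wb).trans hWbΔ.le
  have hlt : b < 2 * Y / (1 + x) ↔ Wb < W := by
    have h : W - Wb = -(2 * x ^ 2 - 2 * x - 1) * (2 * Y - b * (1 + x)) := by
      rw [hWb, hW]; ring
    rw [lt_div_iff₀ h1x, ← sub_pos, ← sub_pos (a := W), h,
      mul_pos_iff_of_pos_left (neg_pos.2 hD)]
  have hroot : μ = (2 * (1 - x) * (2 * x ^ 2 - 8 * x - 1) + Real.sqrt Δ) /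
      (2 * s * (2 * x ^ 2 - 2 * x - 1)) ↔ W = Real.sqrt Δ := by
    have hne : 2 * s * (2 * x ^ 2 - 2 * x - 1) ≠ 0 :=
      mul_ne_zero (by positivity) hD.ne
    rw [eq_div_iff hne, hW, hY]
    constructor <;> intro h <;> linear_combination h
  have hzero : criticalQuadratic b t (2 * Y / (1 + x)) = 0 ↔ W ^ 2 = Δ := by
    rw [hcrit, div_eq_zero_iff, or_iff_left (by positivity), ← sub_eq_zero (a := W ^ 2), hWΔ,
      mul_eq_zero, mul_eq_zero, or_iff_right hD.ne, or_iff_right (by norm_num)]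
  rw [hroot, hlt, hzero]
  constructor
  · intro h
    have h2 : W ^ 2 = Δ := by rw [h, Real.sq_sqrt hΔ0]
    refine ⟨lt_of_pow_lt_pow_left₀ 2 (h ▸ Real.sqrt_nonneg _) (h2 ▸ hWbΔ), h2⟩
  · rintro ⟨h1, h2⟩
    have hsum : 0 < (W - Wb) * (W + Wb) := by
      rw [← h2] at hWbΔ
      linarith [sq_sub_sq W Wb]
    have hW0 : 0 ≤ W := by linarith [pos_of_mul_pos_right hsum (sub_pos.2 h1).le]
    rw [← h2, Real.sqrt_sq hW0]

/-- Here σ* = 4 b r(t) / (z² - b²), whose denominator is positive because z > b. -/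
lemma sigmaStar_le_iff (hb : 0 < b) (hb1 : b < 1) (hx : (2 + b) / (4 - b) < x) (hx1 : x < 1)
    {σ t : ℝ} (hσ : 0 < σ) (ht : t = Real.sqrt (1 - x ^ 2) / (1 + x))
    (hz : b < 1 + -2 * muStar b x * t + 3 * t ^ 2) :
    sigmaStar b x ≤ σ ↔ 0 ≤ vdsDurrleman b (-2 * muStar b x) (4 * b / σ) t := by
  obtain ⟨hbx, hxh⟩ := half_lt_of_lt hb hb1 hx
  have hs2 : Real.sqrt (1 - x ^ 2) ^ 2 = 1 - x ^ 2 := Real.sq_sqrt (by nlinarith)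
  have h1x : 0 < 1 + x := by linarith
  unfold sigmaStar vdsDurrleman
  generalize muStar b x = μ at *
  set s := Real.sqrt (1 - x ^ 2) with hsdef
  have ht2 : t ^ 2 = (1 - x) / (1 + x) := by
    rw [ht, div_pow, hs2]; field_simp; ring
  have hzY : 1 + -2 * μ * t + 3 * t ^ 2 = 2 * (2 - x - μ * s) / (1 + x) := by
    rw [ht2, ht]; field_simp; ring
  have hr : t * (1 - 3 * t ^ 2) / (1 + t ^ 2) = s * (2 * x - 1) / (1 + x) := by
    rw [ht2, ht]
    have : 1 + (1 - x) / (1 + x) = 2 / (1 + x) := by field_simp; ring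
    rw [this]
    field_simp
    ring
  rw [hzY] at hz ⊢
  rw [hr]
  generalize 2 - x - μ * s = Y at *
  have hA : 0 < 4 * Y ^ 2 - b ^ 2 * (1 + x) ^ 2 := by
    rw [lt_div_iff₀ h1x] at hz
    nlinarith [mul_pos hb h1x]
  have hid : (2 * Y / (1 + x)) ^ 2 - b ^ 2 - 4 * b / σ * (s * (2 * x - 1) / (1 + x))
      = (σ * (4 * Y ^ 2 - b ^ 2 * (1 + x) ^ 2) - -(4 * b * s * (1 - x - 2 * x ^ 2)))
        / (σ * (1 + x) ^ 2) := by
    field_simp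
    ring
  rw [hid, div_le_iff₀ hA, le_div_iff₀ (by positivity), zero_mul, sub_nonneg]

end Reparametrization

lemma vanishingDownwardSVI_eq_iff {b m σ μ : ℝ} (hb : 0 < b) (hσ : 0 < σ) :
    (∀ k : ℝ, vanishingDownwardSVI b m σ k =
      b * σ * (-(k / σ) - μ + Real.sqrt ((k / σ + μ) ^ 2 + 1))) ↔ m / σ = -μ := by
  have hsvi (k : ℝ) : vanishingDownwardSVI b m σ k =
      b * σ * (-(k / σ) + m / σ + Real.sqrt ((k / σ - m / σ) ^ 2 + 1)) := by
    have h : Real.sqrt ((k - m) ^ 2 + σ ^ 2) = σ * Real.sqrt ((k / σ - m / σ) ^ 2 + 1) := by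
      rw [show (k - m) ^ 2 + σ ^ 2 = σ ^ 2 * ((k / σ - m / σ) ^ 2 + 1) by field_simp,
        Real.sqrt_mul (sq_nonneg σ), Real.sqrt_sq hσ.le]
    simp only [vanishingDownwardSVI, svi, h]
    field_simp
    ring
  simp only [hsvi]
  constructor
  · intro h
    -- The value at k = 0 already determines m / σ, since p + √(p² + 1) is injective in p.
    have h0 := mul_left_cancel₀ (mul_pos hb hσ).ne' (h 0)
    simp only [zero_div, neg_zero, zero_add, zero_sub, neg_sq] at h0
    generalize m / σ = p at *
    have hp := Real.sq_sqrt (by positivity : 0 ≤ p ^ 2 + 1)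
    have hμ := Real.sq_sqrt (by positivity : 0 ≤ μ ^ 2 + 1)
    have hμlt : |μ| < Real.sqrt (μ ^ 2 + 1) := by
      rw [← Real.sqrt_sq_eq_abs]
      exact Real.sqrt_lt_sqrt (sq_nonneg _) (by linarith)
    have hpos : 0 < -μ + Real.sqrt (μ ^ 2 + 1) := by linarith [le_abs_self μ]
    generalize Real.sqrt (p ^ 2 + 1) = s at *
    generalize Real.sqrt (μ ^ 2 + 1) = r at *
    have hs : s = -μ + r - p := by linarith
    rw [hs] at hp
    have : (-μ + r) * (p + μ) = 0 := by linear_combination (hμ - hp) / 2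
    have := (mul_eq_zero.1 this).resolve_left hpos.ne'
    linarith
  · intro h k
    rw [h, sub_neg_eq_add]
    ring

end

theorem mainTheorem2 :
    (∀ m σ μ : ℝ, 0 < σ → μ = m / σ →
      (IsButterflyArbitrageFree (vanishingDownwardSVI 1 m σ) ↔ 0 < μ ∧ 1 / μ ≤ σ)) ∧
    (∀ b m σ : ℝ, 0 < b → b < 1 → 0 < σ →
      (IsButterflyArbitrageFree (vanishingDownwardSVI b m σ) ↔
        ∃ x : ℝ, (2 + b) / (4 - b) < x ∧ x < 1 ∧
          (∀ k : ℝ, vanishingDownwardSVI b m σ k =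
            b * σ * (-(k / σ) - muStar b x + Real.sqrt ((k / σ + muStar b x) ^ 2 + 1))) ∧
          sigmaStar b x ≤ σ)) := by
  refine ⟨fun m σ μ hσ hμ => ?_, fun b m σ hb hb1 hσ => ?_⟩
  · rw [isButterflyArbitrageFree_vanishingDownwardSVI_iff one_pos hσ,
      forall_vdsDurrleman_one_nonneg_iff (by positivity), ← hμ, div_le_iff₀ hσ]
    constructor
    · intro h
      have hpos : 0 < μ := by
        by_contra! hle
        nlinarith
      exact ⟨hpos, by rw [div_le_iff₀ hpos]; linarith⟩
    · rintro ⟨hpos, h⟩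
      rw [div_le_iff₀ hpos] at h
      linarith
  · rw [isButterflyArbitrageFree_vanishingDownwardSVI_iff hb hσ,
      forall_vdsDurrleman_nonneg_iff hb hb1 (by positivity)]
    simp only [vanishingDownwardSVI_eq_iff hb hσ]
    constructor
    · rintro ⟨t, ht, htb, hz, hQ, h0⟩
      have hx : (2 + b) / (4 - b) < (1 - t ^ 2) / (1 + t ^ 2) := by
        rw [div_lt_div_iff₀ (by linarith) (by positivity)]
        linarith
      have hx1 : (1 - t ^ 2) / (1 + t ^ 2) < 1 := by
        rw [div_lt_one (by positivity)]
        nlinarith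
      have hts : t = Real.sqrt (1 - ((1 - t ^ 2) / (1 + t ^ 2)) ^ 2)
          / (1 + (1 - t ^ 2) / (1 + t ^ 2)) := by
        have h1 : 1 - ((1 - t ^ 2) / (1 + t ^ 2)) ^ 2 = (2 * t / (1 + t ^ 2)) ^ 2 := by
          field_simp; ring
        have h2 : 1 + (1 - t ^ 2) / (1 + t ^ 2) = 2 / (1 + t ^ 2) := by field_simp; ring
        rw [h1, Real.sqrt_sq (by positivity), h2]
        field_simp
      have hM : 2 * (m / σ) = -2 * -(m / σ) := by ring
      rw [hM] at hz hQ h0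
      have hμ := (eq_muStar_iff hb hb1 hx hx1 hts).2 ⟨hz, hQ⟩
      refine ⟨_, hx, hx1, by rw [← hμ, neg_neg], ?_⟩
      rw [hμ] at hz h0
      exact (sigmaStar_le_iff hb hb1 hx hx1 hσ hts hz).2 h0
    · rintro ⟨x, hx, hx1, hm, hσx⟩
      obtain ⟨hbx, hxh⟩ := half_lt_of_lt hb hb1 hx
      obtain ⟨hz, hQ⟩ := (eq_muStar_iff hb hb1 hx hx1 rfl).1 rfl
      have h0 := (sigmaStar_le_iff hb hb1 hx hx1 hσ rfl hz).1 hσx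
      have hM : 2 * (m / σ) = -2 * muStar b x := by rw [hm]; ring
      have hpos : 0 < 1 - x ^ 2 := by nlinarith
      rw [hM]
      refine ⟨_, div_pos (Real.sqrt_pos.2 hpos) (by linarith), ?_, hz, hQ, h0⟩
      rw [div_pow, Real.sq_sqrt hpos.le, ← mul_div_assoc, div_lt_iff₀ (by nlinarith)]
      nlinarith
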